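/- Let $F:\mathbb R^n\to\mathbb R^m$ be continuously differentiable around $\bar x$, let $g:\mathbb R^m\to\overline{\mathbb R}$ be a lower semicontinuous convex function with $F(\bar x)\in\operatorname{dom} g:=\{y: g(y)<\infty\}$, let $\bar y^*\in\partial g(F(\bar x))$, and for $b\in\mathbb R^m$ put $F_b(x):=F(x)+b$. Here $\partial$ is the limiting subdifferential (defined at points where the function is finite), $N$ the limiting normal cone, and $D^*$ the limiting coderivative, $u\in D^*S(x,y)(v)\iff (u,-v)\in N_{\operatorname{gph}S}(x,y)$. Assume that the second-order qualification condition (SOQC) holds at $\bar x$ for $\bar y^*$: $$\nabla F(\bar x)^Tv^*=0,\quad v^*\in D^*(\partial g)(F(\bar x),\bar y^*)(0)\ \Longrightarrow\ v^*=0 .$$ Then the basic constraint qualification $$\nabla F(\bar x)^Tv^*=0,\quad v^*\in N_{\operatorname{dom} g}(F(\bar x))\ \Longrightarrow\ v^*=0$$ holds, and there is an open neighborhood $U$ of $(\bar x,0)$ such that for every $(x,b)\in U$ with $F_b(x)\in\operatorname{dom} g$: 1. $\nabla F_b(x)^Tv^*=0,\ v^*\in N_{\operatorname{dom} g}(F_b(x))\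 \Rightarrow\ v^*=0$; 2. $\partial(g\circ F_b)(x)=\nabla F_b(x)^T\,\partial g(F_b(x))$; 3. if $F$ is twice continuously differentiable around $\bar x$, then $g\circ F_b$ is prox-regular and subdifferentially continuous at $x$, i.e. for $\psi=g\circ F_b$ and every $v\in\partial\psi(x)$: $\psi$ is finite at $x$ and lower semicontinuous on a neighborhood of $x$; there are $\varepsilon>0$, $r\ge0$ with $\psi(u')\ge\psi(u)+\langle w,u'-u\rangle-\frac r2\|u'-u\|^2$ whenever $\|u'-x\|\le\varepsilon$, $\|u-x\|\le\varepsilon$, $w\in\partial\psi(u)$, $\|w-v\|\le\varepsilon$ and $\psi(u)<\psi(x)+\varepsilon$; and $\psi(u_k)\to\psi(x)$ whenever $u_k\to x$, $w_k\in\partial\psi(u_k)$ and $w_k\to v$. -/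

import Mathlib

open Filter Topology Set
open scoped InnerProductSpace

namespace VarAnal

section Functions

variable {E : Type*} [NormedAddCommGroup E] [InnerProductSpace ℝ E]

/-- The effective domain of an extended real-valued function. -/
def effDom (ψ : E → EReal) : Set E := {x | ψ x < ⊤}

/-- Convexity of an extended real-valued function: its epigraph is convex. -/
def IsConvexFun (ψ : E → EReal) : Prop :=
  Convex ℝ {p : E × ℝ | ψ p.1 ≤ (p.2 : EReal)}

/-- The regular subdifferential of `ψ` at `x` (empty where `ψ` is not finite). The condition
`liminf_{u → x, u ≠ x} (ψ u - ψ x - ⟪v, u - x⟫) / ‖u - x‖ ≥ 0` is written without division. -/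
def regSubdiff (ψ : E → EReal) (x : E) : Set E :=
  {v | ψ x ≠ ⊤ ∧ ψ x ≠ ⊥ ∧ ∀ ε : ℝ, 0 < ε →
    ∀ᶠ u in 𝓝 x, ψ x + ((⟪v, u - x⟫_ℝ - ε * ‖u - x‖ : ℝ) : EReal) ≤ ψ u}

/-- The limiting subdifferential of `ψ` at `x` (empty where `ψ` is not finite). -/
def subdiff (ψ : E → EReal) (x : E) : Set E :=
  {v | ψ x ≠ ⊤ ∧ ψ x ≠ ⊥ ∧ ∃ (u : ℕ → E) (w : ℕ → E),
    Tendsto u atTop (𝓝 x) ∧ Tendsto w atTop (𝓝 v) ∧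
    Tendsto (fun k => ψ (u k)) atTop (𝓝 (ψ x)) ∧ ∀ k, w k ∈ regSubdiff ψ (u k)}

/-- `ψ` is prox-regular at `x` for `v`. Lower semicontinuity is required on a neighbourhood of
`x` only, and the inequality is required for subgradients `w ∈ ∂ψ(u)` near `v`. -/
def ProxRegularAtFor (ψ : E → EReal) (x v : E) : Prop :=
  (∃ V ∈ 𝓝 x, LowerSemicontinuousOn ψ V) ∧
  ψ x ≠ ⊤ ∧ ψ x ≠ ⊥ ∧ v ∈ subdiff ψ x ∧
  ∃ ε : ℝ, 0 < ε ∧ ∃ r : ℝ, 0 ≤ r ∧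
    ∀ u' ∈ Metric.closedBall x ε, ∀ u ∈ Metric.closedBall x ε,
    ∀ w ∈ Metric.closedBall v ε, w ∈ subdiff ψ u → ψ u < ψ x + (ε : EReal) →
      ψ u + ((⟪w, u' - u⟫_ℝ - r / 2 * ‖u' - u‖ ^ 2 : ℝ) : EReal) ≤ ψ u'

/-- `ψ` is prox-regular at `x`, i.e. at `x` for every subgradient. -/
def ProxRegularAt (ψ : E → EReal) (x : E) : Prop :=
  ∀ v ∈ subdiff ψ x, ProxRegularAtFor ψ x v

/-- `ψ` is subdifferentially continuous at `x` for `v`. -/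
def SubdiffContinuousAtFor (ψ : E → EReal) (x v : E) : Prop :=
  ∀ (u : ℕ → E) (w : ℕ → E), (∀ k, w k ∈ subdiff ψ (u k)) →
    Tendsto u atTop (𝓝 x) → Tendsto w atTop (𝓝 v) →
    Tendsto (fun k => ψ (u k)) atTop (𝓝 (ψ x))

/-- `ψ` is subdifferentially continuous at `x`, i.e. at `x` for every subgradient. -/
def SubdiffContinuousAt (ψ : E → EReal) (x : E) : Prop :=
  ∀ v ∈ subdiff ψ x, SubdiffContinuousAtFor ψ x v

end Functions

section Cones

variable {E : Type*} [NormedAddCommGroup E] [InnerProductSpace ℝ E]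

/-- The (Bouligand) tangent cone to `Ω` at `z`. -/
def tangentCone (Ω : Set E) (z : E) : Set E :=
  {w | ∃ (t : ℕ → ℝ) (d : ℕ → E), (∀ k, 0 < t k) ∧ Tendsto t atTop (𝓝 0) ∧
    Tendsto d atTop (𝓝 w) ∧ ∀ k, z + t k • d k ∈ Ω}

/-- The regular normal cone: the negative polar of the tangent cone. -/
def regNormalCone (Ω : Set E) (z : E) : Set E :=
  {v | ∀ w ∈ tangentCone Ω z, ⟪v, w⟫_ℝ ≤ 0}

/-- The limiting normal cone to `Ω` at `z` (empty if `z ∉ Ω`). -/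
def normalCone (Ω : Set E) (z : E) : Set E :=
  {v | z ∈ Ω ∧ ∃ (y : ℕ → E) (w : ℕ → E), (∀ k, y k ∈ Ω) ∧ Tendsto y atTop (𝓝 z) ∧
    (∀ k, w k ∈ regNormalCone Ω (y k)) ∧ Tendsto w atTop (𝓝 v)}

end Cones

section Mappings

variable {E G : Type*} [NormedAddCommGroup E] [InnerProductSpace ℝ E]
  [NormedAddCommGroup G] [InnerProductSpace ℝ G]

/-- The graph of a set-valued mapping, in the product with the norm `√(‖x‖² + ‖y‖²)`. -/
def gph (S : E → Set G) : Set (WithLp 2 (E × G)) := {p | p.snd ∈ S p.fst}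

/-- The limiting (Mordukhovich) coderivative `D^*S(x, y)`. -/
def coderivative (S : E → Set G) (x : E) (y : G) (v : G) : Set E :=
  {u | WithLp.toLp 2 (u, -v) ∈ normalCone (gph S) (WithLp.toLp 2 (x, y))}

variable [CompleteSpace E] [CompleteSpace G]

/-- The transposed Jacobian `∇F(x)ᵀ`. -/
noncomputable def jacT (F : E → G) (x : E) : G →L[ℝ] E :=
  ContinuousLinearMap.adjoint (fderiv ℝ F x)

/-- The second-order qualification condition for `g ∘ F` at `x` for `y'`. -/
def SOQC (F : E → G) (g : G → EReal) (x : E) (y' : G) : Prop :=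
  ∀ v : G, jacT F x v = 0 → v ∈ coderivative (subdiff g) (F x) y' 0 → v = 0

/-- The basic constraint qualification for `g ∘ F` at `x`. -/
def BCQ (F : E → G) (g : G → EReal) (x : E) : Prop :=
  ∀ v : G, jacT F x v = 0 → v ∈ normalCone (effDom g) (F x) → v = 0

end Mappings

end VarAnal

/-! For lower semicontinuous convex `g`, limiting subgradients are the convex ones, so `∂g` is
monotone, and normals to `dom g` are convex normals. Adding such a normal `v` to a subgradient `y'`
at `y` gives another subgradient; monotonicity then makes `(v, 0)` a regular normal to `gph ∂g` at
`(y, y')`. Hence SOQC implies BCQ (`SOQC.bcq`), and SOQC plays no further role.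

BCQ is stable under small shifts (`BCQ.eventually`) and bounds multipliers (`BCQ.exists_bound`),
both by compactness: normalized counterexamples converge to a unit vector that BCQ forces to vanish.

In the chain rule, `⊇` is linearization. For `⊆`, penalization gives approximate multipliers at
nearby points (`exists_approx_multiplier`); the bound and the closed graph of `∂g` yield an exact
one in the limit. Subdifferential continuity and prox-regularity follow from the convex subgradient
inequality with bounded multipliers, the latter using the quadratic linearization error of a `C²`
mapping. -/

namespace VarAnal

section Limits

/-- A lower bound that holds for every real number below `γ` holds for `γ`. -/
theorem lower_bound_of_forall_lt {γ s t : ℝ} (h : ∀ a < γ, a + s ≤ t) : γ + s ≤ t := by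
  have : γ ≤ t - s := le_of_forall_lt fun a ha => by
    by_contra hc
    obtain ⟨c, hc1, hc2⟩ := exists_between ha
    linarith [h c hc2]
  linarith

end Limits

/-! ### Convex subgradients, and normals to the domain. -/

section Convex

variable {E : Type*} [NormedAddCommGroup E] [InnerProductSpace ℝ E]

/-- The subdifferential of convex analysis. -/
def convSubdiff (ψ : E → EReal) (x : E) : Set E :=
  {v | ψ x ≠ ⊤ ∧ ψ x ≠ ⊥ ∧ ∀ u, ψ x + ((⟪v, u - x⟫_ℝ : ℝ) : EReal) ≤ ψ u}

/-- Testing against real upper bounds `β` keeps later arguments in `ℝ`, with no case split on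
infinite values. -/
theorem mem_convSubdiff_iff_real {ψ : E → EReal} {x v : E} {γ : ℝ} (hγ : ψ x = γ) :
    v ∈ convSubdiff ψ x ↔ ∀ u, ∀ β : ℝ, ψ u ≤ β → γ + ⟪v, u - x⟫_ℝ ≤ β := by
  constructor
  · rintro ⟨-, -, h⟩ u β hβ
    have := (h u).trans hβ
    rw [hγ] at this
    exact_mod_cast this
  · intro h
    refine ⟨by simp [hγ], by simp [hγ], fun u => ?_⟩
    rw [← EReal.le_of_forall_lt_iff_le]
    intro β hβ
    rw [hγ]
    exact_mod_cast h u β hβ.le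

theorem exists_real_of_mem_convSubdiff {ψ : E → EReal} {x v : E} (h : v ∈ convSubdiff ψ x) :
    ∃ γ : ℝ, ψ x = γ :=
  ⟨(ψ x).toReal, (EReal.coe_toReal h.1 h.2.1).symm⟩

theorem convSubdiff_monotone {ψ : E → EReal} {x y v w : E} (hv : v ∈ convSubdiff ψ x)
    (hw : w ∈ convSubdiff ψ y) : 0 ≤ ⟪y - x, w - v⟫_ℝ := by
  obtain ⟨α, hα⟩ := exists_real_of_mem_convSubdiff hv
  obtain ⟨β, hβ⟩ := exists_real_of_mem_convSubdiff hw
  have h1 := (mem_convSubdiff_iff_real hα).1 hv y β hβ.le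
  have h2 := (mem_convSubdiff_iff_real hβ).1 hw x α hα.le
  have h3 : ⟪w, x - y⟫_ℝ = -⟪w, y - x⟫_ℝ := by rw [← inner_neg_right, neg_sub]
  rw [inner_sub_right, real_inner_comm, real_inner_comm v]
  linarith

theorem IsConvexFun.le_combo {ψ : E → EReal} (hψ : IsConvexFun ψ) {x y : E} {α β t : ℝ}
    (hx : ψ x ≤ α) (hy : ψ y ≤ β) (ht0 : 0 ≤ t) (ht1 : t ≤ 1) :
    ψ (x + t • (y - x)) ≤ ((α + t * (β - α) : ℝ) : EReal) := by
  have h := hψ (show (x, α) ∈ {p : E × ℝ | ψ p.1 ≤ (p.2 : EReal)} from hx)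
    (show (y, β) ∈ {p : E × ℝ | ψ p.1 ≤ (p.2 : EReal)} from hy)
    (sub_nonneg.2 ht1) ht0 (sub_add_cancel 1 t)
  have e1 : x + t • (y - x) = (1 - t) • x + t • y := by module
  have e2 : α + t * (β - α) = (1 - t) * α + t * β := by ring
  rw [e1, e2]
  exact h

theorem IsConvexFun.convex_effDom {ψ : E → EReal} (hψ : IsConvexFun ψ) :
    Convex ℝ (effDom ψ) := by
  rw [convex_iff_add_mem]
  intro x hx y hy a b ha hb hab
  obtain ⟨α, hα, -⟩ := EReal.lt_iff_exists_real_btwn.1 (show ψ x < ⊤ from hx)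
  obtain ⟨β, hβ, -⟩ := EReal.lt_iff_exists_real_btwn.1 (show ψ y < ⊤ from hy)
  have := hψ.le_combo hα.le hβ.le hb (by linarith)
  have e1 : x + b • (y - x) = a • x + b • y := by
    rw [show a = 1 - b by linarith]; module
  rw [e1] at this
  exact this.trans_lt (EReal.coe_lt_top _)

theorem tendsto_add_smul_nhdsGT (x d : E) :
    Tendsto (fun t : ℝ => x + t • d) (𝓝[>] 0) (𝓝 x) := by
  have : Continuous fun t : ℝ => x + t • d := by fun_prop
  simpa using (this.tendsto 0).mono_left nhdsWithin_le_nhds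

theorem IsConvexFun.ne_bot {ψ : E → EReal} (hψ : IsConvexFun ψ) (hlsc : LowerSemicontinuous ψ)
    {x : E} (hx : ψ x ≠ ⊤) (hx' : ψ x ≠ ⊥) (y : E) : ψ y ≠ ⊥ := by
  intro hy
  obtain ⟨γ, hγ⟩ : ∃ γ : ℝ, ψ x = γ := ⟨(ψ x).toReal, (EReal.coe_toReal hx hx').symm⟩
  have h1 : ∀ᶠ u in 𝓝 x, ((γ - 1 : ℝ) : EReal) < ψ u :=
    hlsc x _ (show ((γ - 1 : ℝ) : EReal) < ψ x by rw [hγ]; exact_mod_cast sub_one_lt γ)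
  have h2 := (tendsto_add_smul_nhdsGT x (y - x)).eventually h1
  have h3 : ∀ᶠ t : ℝ in 𝓝[>] 0, 0 < t ∧ t < 1 := Ioo_mem_nhdsGT one_pos
  obtain ⟨t, ht, ht0, ht1⟩ := (h2.and h3).exists
  -- The height `γ - 1 / t` at `y` puts the chord at parameter `t` exactly at `γ - 1`, contradicting
  -- lower semicontinuity at `x`.
  have h4 := hψ.le_combo (x := x) (y := y) (α := γ) (β := γ - 1 / t) hγ.le (by simp [hy])
    ht0.le ht1.le
  have e : γ + t * (γ - 1 / t - γ) = γ - 1 := by field_simp; ring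
  rw [e] at h4
  exact absurd (ht.trans_le h4) (lt_irrefl _)

theorem convSubdiff_subset_regSubdiff (ψ : E → EReal) (x : E) :
    convSubdiff ψ x ⊆ regSubdiff ψ x := by
  rintro v ⟨h1, h2, h3⟩
  refine ⟨h1, h2, fun ε hε => Eventually.of_forall fun u => le_trans ?_ (h3 u)⟩
  gcongr
  have := mul_nonneg hε.le (norm_nonneg (u - x))
  linarith

/-- Convexity turns the local inequality at `x + t(u - x)` into a global one after division by `t`;
then `ε → 0`. -/
theorem IsConvexFun.regSubdiff_subset {ψ : E → EReal} (hψ : IsConvexFun ψ) (x : E) :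
    regSubdiff ψ x ⊆ convSubdiff ψ x := by
  rintro v ⟨h1, h2, h3⟩
  obtain ⟨γ, hγ⟩ : ∃ γ : ℝ, ψ x = γ := ⟨(ψ x).toReal, (EReal.coe_toReal h1 h2).symm⟩
  rw [mem_convSubdiff_iff_real hγ]
  intro u β hβ
  have key : ∀ ε > 0, ⟪v, u - x⟫_ℝ - ε * ‖u - x‖ ≤ β - γ := by
    intro ε hε
    have h4 := (tendsto_add_smul_nhdsGT x (u - x)).eventually (h3 ε hε)
    have h5 : ∀ᶠ t : ℝ in 𝓝[>] 0, 0 < t ∧ t < 1 := Ioo_mem_nhdsGT one_pos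
    obtain ⟨t, ht, ht0, ht1⟩ := (h4.and h5).exists
    have h6 := ht.trans (hψ.le_combo hγ.le hβ ht0.le ht1.le)
    rw [hγ, add_sub_cancel_left, inner_smul_right, norm_smul, Real.norm_of_nonneg ht0.le] at h6
    have h7 : γ + (t * ⟪v, u - x⟫_ℝ - ε * (t * ‖u - x‖)) ≤ γ + t * (β - γ) := by
      exact_mod_cast h6
    have h8 : t * (⟪v, u - x⟫_ℝ - ε * ‖u - x‖) ≤ t * (β - γ) := by linarith
    exact le_of_mul_le_mul_left h8 ht0
  have hlim : Tendsto (fun ε : ℝ => ⟪v, u - x⟫_ℝ - ε * ‖u - x‖) (𝓝[>] 0)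
      (𝓝 (⟪v, u - x⟫_ℝ - 0 * ‖u - x‖)) :=
    ((by fun_prop : Continuous fun ε : ℝ => ⟪v, u - x⟫_ℝ - ε * ‖u - x‖).tendsto 0).mono_left
      nhdsWithin_le_nhds
  have := le_of_tendsto hlim (eventually_mem_nhdsWithin.mono key)
  linarith

/-- The graph of the convex subdifferential is closed; no convergence of values is needed. -/
theorem mem_convSubdiff_of_tendsto {ψ : E → EReal} (hlsc : LowerSemicontinuous ψ) {x v : E}
    (hx : ψ x ≠ ⊤) (hx' : ψ x ≠ ⊥) {u w : ℕ → E} (hu : Tendsto u atTop (𝓝 x))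
    (hw : Tendsto w atTop (𝓝 v)) (h : ∀ k, w k ∈ convSubdiff ψ (u k)) :
    v ∈ convSubdiff ψ x := by
  obtain ⟨γ, hγ⟩ : ∃ γ : ℝ, ψ x = γ := ⟨(ψ x).toReal, (EReal.coe_toReal hx hx').symm⟩
  rw [mem_convSubdiff_iff_real hγ]
  intro z β hβ
  -- Semicontinuity gives `a < ψ (u k)` eventually for each `a < γ`, which replaces convergence of
  -- the values.
  refine lower_bound_of_forall_lt fun a ha => ?_
  have h1 : ∀ᶠ k in atTop, (a : EReal) < ψ (u k) :=
    hu.eventually (hlsc x _ (show (a : EReal) < ψ x by rw [hγ]; exact_mod_cast ha))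
  have h2 : Tendsto (fun k => a + ⟪w k, z - u k⟫_ℝ) atTop (𝓝 (a + ⟪v, z - x⟫_ℝ)) :=
    tendsto_const_nhds.add (hw.inner (tendsto_const_nhds.sub hu))
  refine le_of_tendsto h2 (h1.mono fun k hk => ?_)
  obtain ⟨α, hα⟩ := exists_real_of_mem_convSubdiff (h k)
  have h3 := (mem_convSubdiff_iff_real hα).1 (h k) z β hβ
  rw [hα] at hk
  have : a < α := by exact_mod_cast hk
  linarith

theorem IsConvexFun.subdiff_eq {ψ : E → EReal} (hψ : IsConvexFun ψ)
    (hlsc : LowerSemicontinuous ψ) (x : E) : subdiff ψ x = convSubdiff ψ x := by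
  ext v
  constructor
  · rintro ⟨h1, h2, u, w, hu, hw, -, h⟩
    exact mem_convSubdiff_of_tendsto hlsc h1 h2 hu hw fun k => hψ.regSubdiff_subset _ (h k)
  · intro h
    exact ⟨h.1, h.2.1, fun _ => x, fun _ => v, tendsto_const_nhds, tendsto_const_nhds,
      tendsto_const_nhds, fun _ => convSubdiff_subset_regSubdiff _ _ h⟩

theorem regSubdiff_subset_subdiff (ψ : E → EReal) (x : E) : regSubdiff ψ x ⊆ subdiff ψ x :=
  fun v h => ⟨h.1, h.2.1, fun _ => x, fun _ => v, tendsto_const_nhds, tendsto_const_nhds,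
    tendsto_const_nhds, fun _ => h⟩

theorem regNormalCone_subset_normalCone {Ω : Set E} {z : E} (hz : z ∈ Ω) :
    regNormalCone Ω z ⊆ normalCone Ω z :=
  fun v hv => ⟨hz, fun _ => z, fun _ => v, fun _ => hz, tendsto_const_nhds, fun _ => hv,
    tendsto_const_nhds⟩

theorem mem_regNormalCone_of_inner_le {Ω : Set E} {z v : E}
    (h : ∀ y ∈ Ω, ⟪v, y - z⟫_ℝ ≤ 0) : v ∈ regNormalCone Ω z := by
  rintro w ⟨t, d, ht, -, hd, hΩ⟩
  refine le_of_tendsto (tendsto_const_nhds.inner hd) (Eventually.of_forall fun k => ?_)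
  have := h _ (hΩ k)
  rw [add_sub_cancel_left, inner_smul_right] at this
  exact nonpos_of_mul_nonpos_right this (ht k)

theorem inner_le_of_mem_regNormalCone {Ω : Set E} (hΩ : Convex ℝ Ω) {z v : E} (hz : z ∈ Ω)
    (hv : v ∈ regNormalCone Ω z) {y : E} (hy : y ∈ Ω) : ⟪v, y - z⟫_ℝ ≤ 0 := by
  refine hv _ ⟨fun k => 1 / ((k : ℝ) + 1), fun _ => y - z, fun k => by positivity,
    tendsto_one_div_add_atTop_nhds_zero_nat, tendsto_const_nhds, fun k => ?_⟩
  refine hΩ.add_smul_sub_mem hz hy ⟨by positivity, ?_⟩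
  rw [div_le_one (by positivity)]
  have : (0 : ℝ) ≤ k := k.cast_nonneg
  linarith

/-- The limiting normal cone to a convex set is the normal cone of convex analysis. -/
theorem mem_normalCone_iff_of_convex {Ω : Set E} (hΩ : Convex ℝ Ω) {z v : E} :
    v ∈ normalCone Ω z ↔ z ∈ Ω ∧ ∀ y ∈ Ω, ⟪v, y - z⟫_ℝ ≤ 0 := by
  constructor
  · rintro ⟨hz, y, w, hy, hyz, hw, hwv⟩
    refine ⟨hz, fun p hp => ?_⟩
    exact le_of_tendsto (hwv.inner (tendsto_const_nhds.sub hyz)) (Eventually.of_forall fun k =>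
      inner_le_of_mem_regNormalCone hΩ (hy k) (hw k) hp)
  · rintro ⟨hz, h⟩
    exact regNormalCone_subset_normalCone hz (mem_regNormalCone_of_inner_le h)

theorem add_mem_convSubdiff {ψ : E → EReal} {x y v : E} (hy : y ∈ convSubdiff ψ x)
    (hv : ∀ u ∈ effDom ψ, ⟪v, u - x⟫_ℝ ≤ 0) : y + v ∈ convSubdiff ψ x := by
  obtain ⟨γ, hγ⟩ := exists_real_of_mem_convSubdiff hy
  rw [mem_convSubdiff_iff_real hγ] at hy ⊢
  intro u β hβ
  have h1 := hy u β hβ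
  have h2 := hv u (hβ.trans_lt (EReal.coe_lt_top _))
  rw [inner_add_left]
  linarith

/-- Normals to the domain of a convex function are horizontal normals to the graph of its
subdifferential. -/
theorem normalCone_effDom_subset_coderivative {g : E → EReal} (hg : IsConvexFun g)
    (hlsc : LowerSemicontinuous g) {y y' : E} (hy : y' ∈ subdiff g y) :
    normalCone (effDom g) y ⊆ coderivative (subdiff g) y y' 0 := by
  intro v hv
  rw [mem_normalCone_iff_of_convex hg.convex_effDom] at hv
  refine regNormalCone_subset_normalCone (Ω := gph (subdiff g)) (z := WithLp.toLp 2 (y, y'))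
    hy ?_
  rw [hg.subdiff_eq hlsc] at hy
  -- Monotonicity between `y' + v` at `y` and the perturbed graph point gives, after division by `t
  -- k`, `⟪(d k).fst, t k • (d k).snd - v⟫ ≥ 0`; the limit is `⟪w.fst, -v⟫ ≥ 0`.
  have hyv := add_mem_convSubdiff hy hv.2
  rintro w ⟨t, d, ht, ht0, hd, hgph⟩
  rw [WithLp.prod_inner_apply]
  have hd1 : Tendsto (fun k => (d k).fst) atTop (𝓝 w.fst) :=
    ((WithLp.continuous_fst 2 E E).tendsto w).comp hd
  have hd2 : Tendsto (fun k => (d k).snd) atTop (𝓝 w.snd) :=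
    ((WithLp.continuous_snd 2 E E).tendsto w).comp hd
  have hlim : Tendsto (fun k => ⟪(d k).fst, t k • (d k).snd - v⟫_ℝ) atTop
      (𝓝 ⟪w.fst, (0 : ℝ) • w.snd - v⟫_ℝ) :=
    hd1.inner ((ht0.smul hd2).sub tendsto_const_nhds)
  have h0 := ge_of_tendsto hlim (b := 0) (Eventually.of_forall fun k => by
    have h1 : y' + t k • (d k).snd ∈ subdiff g (y + t k • (d k).fst) := hgph k
    rw [hg.subdiff_eq hlsc] at h1
    have h2 := convSubdiff_monotone hyv h1
    rw [add_sub_cancel_left, add_sub_add_left_eq_sub, inner_smul_left] at h2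
    exact nonneg_of_mul_nonneg_right h2 (ht k))
  rw [zero_smul, zero_sub, inner_neg_right, real_inner_comm] at h0
  simpa using h0

end Convex

/-! ### Consequences of the qualification conditions. -/

section Qualification

theorem tendsto_clm_apply {E G : Type*} [NormedAddCommGroup E] [NormedSpace ℝ E]
    [NormedAddCommGroup G] [NormedSpace ℝ G] {A : ℕ → G →L[ℝ] E} {A₀ : G →L[ℝ] E} {y : ℕ → G}
    {y₀ : G} (hA : Tendsto A atTop (𝓝 A₀)) (hy : Tendsto y atTop (𝓝 y₀)) :
    Tendsto (fun k => A k (y k)) atTop (𝓝 (A₀ y₀)) :=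
  (isBoundedBilinearMap_apply.continuous.tendsto (A₀, y₀)).comp (hA.prodMk_nhds hy)

theorem exists_subseq_tendsto_normalize {G : Type*} [NormedAddCommGroup G]
    [InnerProductSpace ℝ G] [FiniteDimensional ℝ G] {y : ℕ → G} (hy : ∀ k, y k ≠ 0) :
    ∃ v : G, ‖v‖ = 1 ∧ ∃ φ : ℕ → ℕ, StrictMono φ ∧
      Tendsto (fun k => ‖y (φ k)‖⁻¹ • y (φ k)) atTop (𝓝 v) := by
  obtain ⟨v, hv, φ, hφ, hlim⟩ := (isCompact_sphere (0 : G) 1).tendsto_subseq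
    (x := fun k => ‖y k‖⁻¹ • y k) (fun k => by simp [norm_smul, hy k])
  exact ⟨v, by simpa using hv, φ, hφ, hlim⟩

variable {E G : Type*} [NormedAddCommGroup E] [InnerProductSpace ℝ E] [CompleteSpace E]
  [NormedAddCommGroup G] [InnerProductSpace ℝ G] [CompleteSpace G]

theorem jacT_inner (F : E → G) (x : E) (y : G) (d : E) :
    ⟪jacT F x y, d⟫_ℝ = ⟪y, fderiv ℝ F x d⟫_ℝ :=
  ContinuousLinearMap.adjoint_inner_left _ _ _

theorem jacT_add_const (F : E → G) (b : G) (x : E) : jacT (fun z => F z + b) x = jacT F x := by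
  simp only [jacT, fderiv_add_const]

theorem continuousAt_jacT {F : E → G} {x : E} (hF : ContinuousAt (fderiv ℝ F) x) :
    ContinuousAt (jacT F) x :=
  (ContinuousLinearMap.adjoint (𝕜 := ℝ) (E := E) (F := G)).continuous.continuousAt.comp hF

/-- The second-order qualification condition implies the basic constraint qualification. -/
theorem SOQC.bcq {F : E → G} {g : G → EReal} {x : E} {y' : G} (h : SOQC F g x y')
    (hg : IsConvexFun g) (hlsc : LowerSemicontinuous g) (hy : y' ∈ subdiff g (F x)) :
    BCQ F g x :=
  fun v hv hN => h v hv (normalCone_effDom_subset_coderivative hg hlsc hy hN)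

variable [FiniteDimensional ℝ G]

/-- The basic constraint qualification persists under small shifts of the point and the value. -/
theorem BCQ.eventually {F : E → G} {g : G → EReal} {x : E} (h : BCQ F g x)
    (hg : IsConvexFun g) (hx : F x ∈ effDom g) (hFc : ContinuousAt F x)
    (hF' : ContinuousAt (fderiv ℝ F) x) :
    ∀ᶠ p : E × G in 𝓝 (x, 0), F p.1 + p.2 ∈ effDom g → BCQ (fun z => F z + p.2) g p.1 := by
  by_contra hcon
  obtain ⟨p, hp, hbad⟩ := exists_seq_forall_of_frequently (not_eventually.1 hcon)
  have hbad' : ∀ k, ∃ v : G, jacT F (p k).1 v = 0 ∧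
      v ∈ normalCone (effDom g) (F (p k).1 + (p k).2) ∧ v ≠ 0 := by
    intro k
    have := hbad k
    simp only [BCQ, jacT_add_const] at this
    push Not at this
    exact this.2
  choose y hy1 hy2 hy3 using hbad'
  obtain ⟨v, hv, φ, hφ, hlim⟩ := exists_subseq_tendsto_normalize hy3
  have hp1 : Tendsto (fun k => (p (φ k)).1) atTop (𝓝 x) :=
    (continuous_fst.tendsto _).comp (hp.comp hφ.tendsto_atTop)
  have hp2 : Tendsto (fun k => (p (φ k)).2) atTop (𝓝 0) :=
    (continuous_snd.tendsto _).comp (hp.comp hφ.tendsto_atTop)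
  have hval : Tendsto (fun k => F (p (φ k)).1 + (p (φ k)).2) atTop (𝓝 (F x)) := by
    simpa using (hFc.tendsto.comp hp1).add hp2
  have hv0 : v = 0 := by
    refine h v ?_ ((mem_normalCone_iff_of_convex hg.convex_effDom).2 ⟨hx, fun z hz => ?_⟩)
    · have h1 : Tendsto (fun k => jacT F (p (φ k)).1) atTop (𝓝 (jacT F x)) :=
        (continuousAt_jacT hF').tendsto.comp hp1
      have h1 := tendsto_clm_apply h1 hlim
      refine tendsto_nhds_unique h1 (tendsto_const_nhds.congr fun k => ?_)
      simp [hy1]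
    · refine le_of_tendsto (hlim.inner (tendsto_const_nhds.sub hval))
        (Eventually.of_forall fun k => ?_)
      have := ((mem_normalCone_iff_of_convex hg.convex_effDom).1 (hy2 (φ k))).2 z hz
      rw [real_inner_smul_left]
      exact mul_nonpos_of_nonneg_of_nonpos (by positivity) this
  simp [hv0] at hv

/-- Under the basic constraint qualification multipliers are controlled by their images. -/
theorem BCQ.exists_bound {F : E → G} {g : G → EReal} {x : E} (h : BCQ F g x)
    (hg : IsConvexFun g) (hlsc : LowerSemicontinuous g) (hx : g (F x) ≠ ⊤) (hx' : g (F x) ≠ ⊥)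
    (hF' : ContinuousAt (fderiv ℝ F) x) :
    ∃ ε > 0, ∃ κ > 0, ∀ (z : E) (y y' : G), ‖z - x‖ ≤ ε → ‖y - F x‖ ≤ ε →
      y' ∈ convSubdiff g y → ‖y'‖ ≤ κ * (1 + ‖jacT F z y'‖) := by
  obtain ⟨γ, hγ⟩ : ∃ γ : ℝ, g (F x) = γ := ⟨_, (EReal.coe_toReal hx hx').symm⟩
  by_contra! hcon
  have hpos : ∀ k : ℕ, (0 : ℝ) < 1 / ((k : ℝ) + 1) := fun k => by positivity
  -- With `κ = k + 1`, failure of the bound gives both `‖y' k‖ > k + 1` and an image of the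
  -- normalized multiplier smaller than `1 / (k + 1)`.
  choose z y y' hz hy hy' hbig using fun k : ℕ =>
    hcon (1 / ((k : ℝ) + 1)) (hpos k) ((k : ℝ) + 1) (by positivity)
  have hlarge : ∀ k : ℕ, (k : ℝ) + 1 < ‖y' k‖ := fun k => by
    refine lt_of_le_of_lt ?_ (hbig k)
    have : (0 : ℝ) ≤ ((k : ℝ) + 1) * ‖jacT F (z k) (y' k)‖ := by positivity
    linarith
  have hne : ∀ k, y' k ≠ 0 := fun k => norm_pos_iff.1 (lt_trans (by positivity) (hlarge k))
  obtain ⟨v, hv, φ, hφ, hlim⟩ := exists_subseq_tendsto_normalize hne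
  have hinv : Tendsto (fun k : ℕ => 1 / ((φ k : ℝ) + 1)) atTop (𝓝 0) :=
    tendsto_one_div_add_atTop_nhds_zero_nat.comp hφ.tendsto_atTop
  have hz1 : Tendsto (fun k => z (φ k)) atTop (𝓝 x) :=
    tendsto_iff_norm_sub_tendsto_zero.2
      (squeeze_zero (fun _ => norm_nonneg _) (fun k => hz (φ k)) hinv)
  have hy1 : Tendsto (fun k => y (φ k)) atTop (𝓝 (F x)) :=
    tendsto_iff_norm_sub_tendsto_zero.2
      (squeeze_zero (fun _ => norm_nonneg _) (fun k => hy (φ k)) hinv)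
  have hscale : ∀ k : ℕ, ‖y' k‖⁻¹ ≤ 1 / ((k : ℝ) + 1) := fun k => by
    rw [one_div]
    exact inv_anti₀ (by positivity) (hlarge k).le
  have hv0 : v = 0 := by
    refine h v ?_ ((mem_normalCone_iff_of_convex hg.convex_effDom).2
      ⟨hx.lt_top, fun p hp => ?_⟩)
    · have h1 : Tendsto (fun k => jacT F (z (φ k))) atTop (𝓝 (jacT F x)) :=
        (continuousAt_jacT hF').tendsto.comp hz1
      have h1 := tendsto_clm_apply h1 hlim
      refine tendsto_nhds_unique h1 (squeeze_zero_norm (fun k => ?_) hinv)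
      have h2 := hbig (φ k)
      have h3 : (0 : ℝ) < (φ k : ℝ) + 1 := by positivity
      have h4 : 0 < ‖y' (φ k)‖ := norm_pos_iff.2 (hne _)
      simp only [map_smul, norm_smul, norm_inv, norm_norm]
      rw [inv_mul_le_iff₀ h4, mul_one_div, le_div_iff₀ h3]
      nlinarith
    -- Since `g (y (φ k)) > γ - 1` eventually, dividing the subgradient inequality by `‖y' (φ k)‖`
    -- removes the values and leaves the normal inequality at `p`.
    · obtain ⟨β, hβ, -⟩ := EReal.lt_iff_exists_real_btwn.1 (show g p < ⊤ from hp)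
      have h1 : ∀ᶠ k in atTop, ((γ - 1 : ℝ) : EReal) < g (y (φ k)) :=
        hy1.eventually (hlsc (F x) _
          (show ((γ - 1 : ℝ) : EReal) < g (F x) by rw [hγ]; exact_mod_cast sub_one_lt γ))
      have h2 : Tendsto (fun k : ℕ => 1 / ((φ k : ℝ) + 1) * |β - (γ - 1)|) atTop (𝓝 0) := by
        simpa using hinv.mul_const |β - (γ - 1)|
      refine le_of_tendsto_of_tendsto (hlim.inner (tendsto_const_nhds.sub hy1)) h2
        (h1.mono fun k hk => ?_)
      obtain ⟨α, hα⟩ := exists_real_of_mem_convSubdiff (hy' (φ k))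
      have h3 := (mem_convSubdiff_iff_real hα).1 (hy' (φ k)) p β hβ.le
      rw [hα] at hk
      have h4 : γ - 1 < α := by exact_mod_cast hk
      simp only [real_inner_smul_left]
      calc ‖y' (φ k)‖⁻¹ * ⟪y' (φ k), p - y (φ k)⟫_ℝ
          ≤ ‖y' (φ k)‖⁻¹ * |β - (γ - 1)| := by
            gcongr
            exact le_trans (by linarith) (le_abs_self _)
        _ ≤ 1 / ((φ k : ℝ) + 1) * |β - (γ - 1)| := by
            gcongr
            exact hscale _
  simp [hv0] at hv

end Qualification

/-! ### Penalization and first-order conditions. -/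

section Multipliers

variable {E G : Type*} [NormedAddCommGroup E] [InnerProductSpace ℝ E]
  [NormedAddCommGroup G] [InnerProductSpace ℝ G]

theorem coe_sub_le_of_coe_le_add {a c : ℝ} {x : EReal} (h : (a : EReal) ≤ x + (c : EReal)) :
    ((a - c : ℝ) : EReal) ≤ x := by
  induction x with
  | bot => simp at h
  | top => exact le_top
  | coe x =>
    have : a ≤ x + c := by exact_mod_cast h
    exact_mod_cast (by linarith : a - c ≤ x)

theorem neg_mul_norm_le_fderiv_of_eventually {h : E → ℝ} {h' : E →L[ℝ] ℝ} {z : E} {c : ℝ}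
    (hh : HasFDerivAt h h' z) (hmin : ∀ᶠ z' in 𝓝 z, h z - c * ‖z' - z‖ ≤ h z') (d : E) :
    -(c * ‖d‖) ≤ h' d := by
  refine ge_of_tendsto (hh.lim_real d) ?_
  have h1 : Tendsto (fun s : ℝ => z + s⁻¹ • d) atTop (𝓝 z) := by
    simpa using ((tendsto_inv_atTop_zero (𝕜 := ℝ)).smul_const d).const_add z
  filter_upwards [h1.eventually hmin, eventually_gt_atTop 0] with s hs hs0
  rw [add_sub_cancel_left, norm_smul, norm_inv, Real.norm_of_nonneg hs0.le] at hs
  have h2 : s * (-(c * (s⁻¹ * ‖d‖))) ≤ s * (h (z + s⁻¹ • d) - h z) := by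
    gcongr
    linarith
  have h3 : s * (-(c * (s⁻¹ * ‖d‖))) = -(c * ‖d‖) := by field_simp
  rw [smul_eq_mul]
  linarith

/-- A local minimizer of `g + (k / 2) ‖a - ·‖²` yields a proximal subgradient. -/
theorem smul_sub_mem_regSubdiff {g : G → EReal} {a y : G} {k : ℝ}
    (h1 : g y ≠ ⊤) (h2 : g y ≠ ⊥)
    (hmin : ∀ᶠ p in 𝓝 y, g y + ((k / 2 * ‖a - y‖ ^ 2 : ℝ) : EReal) ≤
      g p + ((k / 2 * ‖a - p‖ ^ 2 : ℝ) : EReal)) :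
    k • (a - y) ∈ regSubdiff g y := by
  obtain ⟨γ, hγ⟩ : ∃ γ : ℝ, g y = γ := ⟨_, (EReal.coe_toReal h1 h2).symm⟩
  refine ⟨h1, h2, fun ε hε => ?_⟩
  -- Expanding the square leaves the remainder `k / 2 * ‖p - y‖ ^ 2`, which this bound absorbs into
  -- `ε * ‖p - y‖`.
  have hsmall : ∀ᶠ p in 𝓝 y, k / 2 * ‖p - y‖ < ε := by
    have : Continuous fun p : G => k / 2 * ‖p - y‖ := by fun_prop
    exact this.continuousAt.eventually_lt continuousAt_const (by simpa using hε)
  filter_upwards [hmin, hsmall] with p hp hps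
  rw [hγ, ← EReal.coe_add] at hp
  rw [hγ, ← EReal.coe_add]
  refine le_trans ?_ (coe_sub_le_of_coe_le_add hp)
  have e : ‖a - p‖ ^ 2 = ‖a - y‖ ^ 2 - 2 * ⟪a - y, p - y⟫_ℝ + ‖p - y‖ ^ 2 := by
    rw [← norm_sub_sq_real, sub_sub_sub_cancel_right]
  rw [real_inner_smul_left, e]
  have := mul_le_mul_of_nonneg_right hps.le (norm_nonneg (p - y))
  exact_mod_cast (by nlinarith)

variable [FiniteDimensional ℝ E] [FiniteDimensional ℝ G]

/-- The penalized problem behind the fuzzy chain rule: its minimizers tend to `(u, F u)`. -/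
theorem exists_penalized_minimizer {F : E → G} {g : G → EReal} (hlsc : LowerSemicontinuous g)
    (hbot : ∀ y, g y ≠ ⊥) {u w : E} {ε δ : ℝ} (hε : 0 < ε) (hδ : 0 < δ)
    (hFc : ContinuousOn F (Metric.closedBall u δ)) (hu : g (F u) ≠ ⊤)
    (hw : ∀ z ∈ Metric.closedBall u δ,
      g (F u) + ((⟪w, z - u⟫_ℝ - ε * ‖z - u‖ : ℝ) : EReal) ≤ g (F z)) :
    ∃ k : ℝ, ∃ z ∈ Metric.ball u δ, ∃ y ∈ Metric.ball (F u) δ, g y ≠ ⊤ ∧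
      ∀ z' ∈ Metric.closedBall u δ, ∀ y₁ ∈ Metric.closedBall (F u) δ,
        g y + ((k / 2 * ‖F z - y‖ ^ 2 - ⟪w, z - u⟫_ℝ + 2 * ε * ‖z - u‖ : ℝ) : EReal) ≤
        g y₁ + ((k / 2 * ‖F z' - y₁‖ ^ 2 - ⟪w, z' - u⟫_ℝ + 2 * ε * ‖z' - u‖ : ℝ) : EReal) := by
  obtain ⟨γ, hγ⟩ : ∃ γ : ℝ, g (F u) = γ := ⟨_, (EReal.coe_toReal hu (hbot _)).symm⟩
  set K : Set (E × G) := Metric.closedBall u δ ×ˢ Metric.closedBall (F u) δ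
  have hKc : IsCompact K := (isCompact_closedBall _ _).prod (isCompact_closedBall _ _)
  have hmem : (u, F u) ∈ K :=
    ⟨Metric.mem_closedBall_self hδ.le, Metric.mem_closedBall_self hδ.le⟩
  have hg2 : LowerSemicontinuousOn (fun p : E × G => g p.2) K := fun p _ a ha =>
    ((continuous_snd.tendsto p).mono_left nhdsWithin_le_nhds).eventually (hlsc p.2 a ha)
  have hFK : ContinuousOn (fun p : E × G => F p.1) K :=
    hFc.comp continuousOn_fst fun p hp => hp.1
  obtain ⟨L, hL⟩ : ∃ L : ℝ, ∀ p ∈ K, (L : EReal) ≤ g p.2 := by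
    obtain ⟨p, -, hp⟩ := hg2.exists_isMinOn ⟨_, hmem⟩ hKc
    obtain ⟨L, -, hL⟩ := EReal.lt_iff_exists_real_btwn.1 (bot_lt_iff_ne_bot.2 (hbot p.2))
    exact ⟨L, fun q hq => hL.le.trans (hp hq)⟩
  let h : ℕ → E × G → ℝ := fun k p =>
    (k : ℝ) / 2 * ‖F p.1 - p.2‖ ^ 2 - ⟪w, p.1 - u⟫_ℝ + 2 * ε * ‖p.1 - u‖
  have hhc : ∀ k, ContinuousOn (h k) K := fun k => by
    refine ContinuousOn.add (ContinuousOn.sub ?_ ?_) ?_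
    · exact continuousOn_const.mul ((hFK.sub continuousOn_snd).norm.pow 2)
    · fun_prop
    · fun_prop
  have hmin : ∀ k, ∃ p ∈ K, ∀ q ∈ K, g p.2 + (h k p : EReal) ≤ g q.2 + (h k q : EReal) := by
    intro k
    have hl : LowerSemicontinuousOn (fun p => g p.2 + (h k p : EReal)) K := by
      refine hg2.add' (continuous_coe_real_ereal.comp_continuousOn (hhc k)).lowerSemicontinuousOn
        fun p _ => EReal.continuousAt_add (by simp) (by simp)
    exact hl.exists_isMinOn ⟨_, hmem⟩ hKc
  choose p hpK hpmin using hmin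
  have hpγ : ∀ k, g (p k).2 + (h k (p k) : EReal) ≤ γ := fun k => by
    simpa [h, hγ] using hpmin k _ hmem
  have hptop : ∀ k, g (p k).2 ≠ ⊤ := fun k hk => by simpa [hk] using hpγ k
  have hreal : ∀ k, ∃ α : ℝ, g (p k).2 = α := fun k =>
    ⟨_, (EReal.coe_toReal (hptop k) (hbot _)).symm⟩
  choose α hα using hreal
  have hαγ : ∀ k, α k + h k (p k) ≤ γ := fun k => by
    have := hpγ k
    rw [hα] at this
    exact_mod_cast this
  have hLα : ∀ k, L ≤ α k := fun k => by
    have := hL _ (hpK k)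
    rw [hα] at this
    exact_mod_cast this
  obtain ⟨q, hqK, φ, hφ, hlim⟩ := hKc.tendsto_subseq hpK
  have hl1 : Tendsto (fun k => (p (φ k)).1) atTop (𝓝 q.1) := (continuous_fst.tendsto _).comp hlim
  have hl2 : Tendsto (fun k => (p (φ k)).2) atTop (𝓝 q.2) := (continuous_snd.tendsto _).comp hlim
  have hlF : Tendsto (fun k => F (p (φ k)).1) atTop (𝓝 (F q.1)) :=
    (hFK q hqK).tendsto.comp
      (tendsto_nhdsWithin_iff.2 ⟨hlim, Eventually.of_forall fun k => hpK (φ k)⟩)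
  have hinner : ∀ k, ⟪w, (p k).1 - u⟫_ℝ ≤ ‖w‖ * δ := fun k => by
    refine (real_inner_le_norm _ _).trans ?_
    gcongr
    exact mem_closedBall_iff_norm.1 (hpK k).1
  -- The minimal values are at most `γ` and `g ≥ L` on `K`, so the squared distance `‖F z - y‖ ^ 2`
  -- is `O(1 / k)` along the minimizers.
  have hFq : F q.1 = q.2 := by
    have h1 : Tendsto (fun k => ‖F (p (φ k)).1 - (p (φ k)).2‖ ^ 2) atTop
        (𝓝 (‖F q.1 - q.2‖ ^ 2)) := ((hlF.sub hl2).norm).pow 2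
    have h2 : Tendsto (fun k => (2 * (γ - L + ‖w‖ * δ)) * (1 / ((φ k : ℕ) : ℝ))) atTop (𝓝 0) := by
      simpa using (tendsto_one_div_atTop_nhds_zero_nat.comp hφ.tendsto_atTop).const_mul
        (2 * (γ - L + ‖w‖ * δ))
    have h3 : ‖F q.1 - q.2‖ ^ 2 ≤ 0 := by
      refine le_of_tendsto_of_tendsto h1 h2 ?_
      filter_upwards [eventually_ge_atTop 1] with k hk
      have hk' : (0 : ℝ) < φ k := by exact_mod_cast lt_of_lt_of_le hk (hφ.id_le k)
      have h4 := hαγ (φ k)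
      have h5 := hLα (φ k)
      have h6 := hinner (φ k)
      have h7 : 0 ≤ 2 * ε * ‖(p (φ k)).1 - u‖ := by positivity
      simp only [h] at h4
      rw [mul_one_div, le_div_iff₀ hk']
      linarith
    have h4 : ‖F q.1 - q.2‖ = 0 := by
      have := sq_nonneg ‖F q.1 - q.2‖
      exact pow_eq_zero_iff two_ne_zero |>.1 (le_antisymm h3 this)
    exact sub_eq_zero.1 (norm_eq_zero.1 h4)
  -- Minimality in the limit carries `2 * ε`, while `hw` carries only `ε`; the difference leaves `ε
  -- * ‖q.1 - u‖ ≤ 0`.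
  have hqu : q.1 = u := by
    have h1 := hw q.1 hqK.1
    rw [hγ, ← EReal.coe_add, hFq] at h1
    have h2 : (γ + (⟪w, q.1 - u⟫_ℝ - ε * ‖q.1 - u‖)) +
        (-⟪w, q.1 - u⟫_ℝ + 2 * ε * ‖q.1 - u‖) ≤ γ := by
      refine lower_bound_of_forall_lt fun a ha => ?_
      have h3 : ∀ᶠ k in atTop, (a : EReal) < g (p (φ k)).2 :=
        hl2.eventually (hlsc q.2 _ (lt_of_lt_of_le (by exact_mod_cast ha) h1))
      have h4 : Tendsto (fun k => a + (-⟪w, (p (φ k)).1 - u⟫_ℝ + 2 * ε * ‖(p (φ k)).1 - u‖)) atTop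
          (𝓝 (a + (-⟪w, q.1 - u⟫_ℝ + 2 * ε * ‖q.1 - u‖))) :=
        ((by fun_prop : Continuous fun z : E =>
          a + (-⟪w, z - u⟫_ℝ + 2 * ε * ‖z - u‖)).tendsto q.1).comp hl1
      refine le_of_tendsto h4 (h3.mono fun k hk => ?_)
      rw [hα] at hk
      have h5 : a < α (φ k) := by exact_mod_cast hk
      have h6 := hαγ (φ k)
      simp only [h] at h6
      have h7 : 0 ≤ ((φ k : ℕ) : ℝ) / 2 * ‖F (p (φ k)).1 - (p (φ k)).2‖ ^ 2 := by positivity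
      linarith
    have h3 : ε * ‖q.1 - u‖ ≤ 0 := by linarith
    have h4 : ‖q.1 - u‖ ≤ 0 := nonpos_of_mul_nonpos_right h3 hε
    exact sub_eq_zero.1 (norm_le_zero_iff.1 h4)
  rw [hqu] at hl1
  rw [← hFq, hqu] at hl2
  obtain ⟨k, hk1, hk2⟩ := ((hl1.eventually (Metric.ball_mem_nhds u hδ)).and
    (hl2.eventually (Metric.ball_mem_nhds (F u) hδ))).exists
  exact ⟨φ k, (p (φ k)).1, hk1, (p (φ k)).2, hk2, hptop _,
    fun z' hz' y₁ hy₁ => hpmin (φ k) (z', y₁) ⟨hz', hy₁⟩⟩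

end Multipliers

/-! ### Second-order estimate for the inner mapping. -/

section Linearization

variable {E G : Type*} [NormedAddCommGroup E] [NormedSpace ℝ E]
  [NormedAddCommGroup G] [NormedSpace ℝ G]

/-- Quadratic error bound for the linearization of a `C²` mapping. -/
theorem exists_norm_sub_sub_fderiv_le {F : E → G} {x : E} (hF : ContDiffAt ℝ 2 F x) :
    ∃ K : ℝ, 0 ≤ K ∧ ∃ ε > 0, ∀ u ∈ Metric.closedBall x ε, ∀ u' ∈ Metric.closedBall x ε,
      ‖F u' - F u - fderiv ℝ F u (u' - u)‖ ≤ K * ‖u' - u‖ ^ 2 := by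
  have h1 : ContDiffAt ℝ 1 (fderiv ℝ F) x := hF.fderiv_right (by norm_num)
  obtain ⟨K, t, ht, hK⟩ := h1.exists_lipschitzOnWith
  have hd : ∀ᶠ z in 𝓝 x, DifferentiableAt ℝ F z :=
    (hF.eventually (by simp)).mono fun z hz => hz.differentiableAt two_ne_zero
  obtain ⟨ε, hε, hball⟩ := Metric.nhds_basis_closedBall.eventually_iff.1
    (hd.and ht)
  refine ⟨K, K.2, ε, hε, fun u hu u' hu' => ?_⟩
  have hseg : segment ℝ u u' ⊆ Metric.closedBall x ε :=
    (convex_closedBall x ε).segment_subset hu hu'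
  have h2 := (convex_segment u u').norm_image_sub_le_of_norm_fderiv_le' (𝕜 := ℝ) (f := F)
    (C := K * ‖u' - u‖) (φ := fderiv ℝ F u) (fun z hz => (hball (hseg hz)).1) (fun z hz => ?_)
    (left_mem_segment ℝ u u') (right_mem_segment ℝ u u')
  · rw [pow_two, ← mul_assoc]
    exact h2
  · refine (hK.norm_sub_le (hball (hseg hz)).2 (hball hu).2).trans ?_
    gcongr
    exact norm_sub_le_of_mem_segment hz

end Linearization

/-! ### Chain rule, subdifferential continuity and prox-regularity. -/

section ChainRule

variable {E G : Type*} [NormedAddCommGroup E] [InnerProductSpace ℝ E] [FiniteDimensional ℝ E]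
  [NormedAddCommGroup G] [InnerProductSpace ℝ G] [FiniteDimensional ℝ G]

/-- Fuzzy chain rule for regular subgradients; it needs no constraint qualification. -/
theorem exists_approx_multiplier {F : E → G} {g : G → EReal} (hg : IsConvexFun g)
    (hlsc : LowerSemicontinuous g) {u w : E} (hF : ∀ᶠ z in 𝓝 u, DifferentiableAt ℝ F z)
    (hw : w ∈ regSubdiff (fun z => g (F z)) u) {η : ℝ} (hη : 0 < η) :
    ∃ (z : E) (y y' : G), ‖z - u‖ ≤ η ∧ ‖y - F u‖ ≤ η ∧ y' ∈ convSubdiff g y ∧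
      ‖jacT F z y' - w‖ ≤ η := by
  obtain ⟨hu, hu', hreg⟩ := hw
  have hbot := hg.ne_bot hlsc hu hu'
  -- The penalty doubles the tolerance, so `η / 2` produces the final error `η`.
  obtain ⟨δ₀, hδ₀, hball⟩ := Metric.nhds_basis_closedBall.eventually_iff.1
    (hF.and (hreg (η / 2) (half_pos hη)))
  set δ := min δ₀ η
  have hδ : 0 < δ := lt_min hδ₀ hη
  have hsub : Metric.closedBall u δ ⊆ Metric.closedBall u δ₀ :=
    Metric.closedBall_subset_closedBall (min_le_left _ _)
  obtain ⟨k, z, hz, y, hy, hytop, hmin⟩ := exists_penalized_minimizer (w := w) hlsc hbot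
    (half_pos hη) hδ (fun z hz => (hball (hsub hz)).1.continuousAt.continuousWithinAt) hu
    (fun z hz => (hball (hsub hz)).2)
  have hzK := Metric.ball_subset_closedBall hz
  have hyK := Metric.ball_subset_closedBall hy
  have hzn : ‖z - u‖ < δ := mem_ball_iff_norm.1 hz
  have hyn : ‖y - F u‖ < δ := mem_ball_iff_norm.1 hy
  obtain ⟨γ, hγ⟩ : ∃ γ : ℝ, g y = γ := ⟨_, (EReal.coe_toReal hytop (hbot _)).symm⟩
  -- Minimality in `y` alone makes `k • (F z - y)` a subgradient; minimality in `z` alone bounds the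
  -- residual by `η`. Both are local because `z` and `y` lie in open balls.
  refine ⟨z, y, k • (F z - y), hzn.le.trans (min_le_right _ _), hyn.le.trans (min_le_right _ _),
    hg.regSubdiff_subset _ (smul_sub_mem_regSubdiff hytop (hbot _) ?_), ?_⟩
  · filter_upwards [Metric.isOpen_ball.mem_nhds hy] with q hq
    have h1 := hmin z hzK q (Metric.ball_subset_closedBall hq)
    by_cases hq' : g q = ⊤
    · rw [hq', EReal.top_add_coe]
      exact le_top
    obtain ⟨α, hα⟩ : ∃ α : ℝ, g q = α := ⟨_, (EReal.coe_toReal hq' (hbot _)).symm⟩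
    rw [hγ, hα, ← EReal.coe_add, ← EReal.coe_add, EReal.coe_le_coe_iff] at h1
    rw [hγ, hα, ← EReal.coe_add, ← EReal.coe_add, EReal.coe_le_coe_iff]
    linarith
  · set d := jacT F z (k • (F z - y)) - w with hd
    have hFz : HasFDerivAt F (fderiv ℝ F z) z := (hball (hsub hzK)).1.hasFDerivAt
    have hder : HasFDerivAt (fun z' => k / 2 * ‖F z' - y‖ ^ 2 - ⟪w, z' - u⟫_ℝ)
        ((k / 2) • (2 • (innerSL ℝ (F z - y)).comp (fderiv ℝ F z)) - innerSL ℝ w) z := by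
      refine ((hFz.sub_const y).norm_sq.const_mul (k / 2)).sub ?_
      exact (innerSL ℝ w).hasFDerivAt.comp z ((hasFDerivAt_id z).sub_const u)
    have hloc : ∀ᶠ z' in 𝓝 z, (k / 2 * ‖F z - y‖ ^ 2 - ⟪w, z - u⟫_ℝ) - η * ‖z' - z‖ ≤
        k / 2 * ‖F z' - y‖ ^ 2 - ⟪w, z' - u⟫_ℝ := by
      filter_upwards [Metric.isOpen_ball.mem_nhds hz] with z' hz'
      have h1 := hmin z' (Metric.ball_subset_closedBall hz') y hyK
      rw [hγ] at h1
      norm_cast at h1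
      have h2 : ‖z' - u‖ ≤ ‖z' - z‖ + ‖z - u‖ := norm_sub_le_norm_sub_add_norm_sub _ _ _
      have h3 := mul_le_mul_of_nonneg_left h2 hη.le
      linarith
    have h1 := neg_mul_norm_le_fderiv_of_eventually hder hloc (-d)
    have h2 : ((k / 2) • (2 • (innerSL ℝ (F z - y)).comp (fderiv ℝ F z)) - innerSL ℝ w) (-d) =
        -⟪d, d⟫_ℝ := by
      have h3 : ⟪d, d⟫_ℝ = k * ⟪F z - y, fderiv ℝ F z d⟫_ℝ - ⟪w, d⟫_ℝ := by
        nth_rewrite 1 [hd]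
        rw [inner_sub_left, jacT_inner, real_inner_smul_left]
      rw [h3]
      simp [-map_sub]
      ring
    rw [h2, real_inner_self_eq_norm_sq, norm_neg] at h1
    by_contra! hcon
    nlinarith [norm_nonneg d]

/-- Limits of regular subgradients of `g ∘ F` have exact multipliers. -/
theorem exists_multiplier_of_tendsto {F : E → G} {g : G → EReal} (hg : IsConvexFun g)
    (hlsc : LowerSemicontinuous g) {x v : E} (hF : ContDiffAt ℝ 1 F x) (hB : BCQ F g x)
    (hx : g (F x) ≠ ⊤) (hx' : g (F x) ≠ ⊥) {u w : ℕ → E} (hu : Tendsto u atTop (𝓝 x))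
    (hw : Tendsto w atTop (𝓝 v)) (h : ∀ k, w k ∈ regSubdiff (fun z => g (F z)) (u k)) :
    ∃ y' ∈ convSubdiff g (F x), jacT F x y' = v := by
  have hF' : ContinuousAt (fderiv ℝ F) x := hF.continuousAt_fderiv one_ne_zero
  have hdiff : ∀ᶠ z in 𝓝 x, ∀ᶠ z' in 𝓝 z, DifferentiableAt ℝ F z' :=
    ((hF.eventually (by simp)).mono fun z hz => hz.differentiableAt one_ne_zero).eventually_nhds
  -- Shifting indices by `N` makes `F` differentiable near every `u (k + N)`.
  obtain ⟨N, hN⟩ := eventually_atTop.1 (hu.eventually hdiff)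
  choose z y y' hz hy hy' hjac using fun k : ℕ =>
    exists_approx_multiplier hg hlsc (hN (k + N) (Nat.le_add_left _ _)) (h (k + N))
      (show (0 : ℝ) < 1 / ((k : ℝ) + 1) by positivity)
  have hinv := tendsto_one_div_add_atTop_nhds_zero_nat (𝕜 := ℝ)
  have hz0 : Tendsto z atTop (𝓝 x) := by
    have h1 : Tendsto (fun k => z k - u (k + N)) atTop (𝓝 0) := squeeze_zero_norm hz hinv
    simpa using h1.add ((tendsto_add_atTop_iff_nat N).2 hu)
  have hy0 : Tendsto y atTop (𝓝 (F x)) := by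
    have h1 : Tendsto (fun k => y k - F (u (k + N))) atTop (𝓝 0) := squeeze_zero_norm hy hinv
    simpa using h1.add (hF.continuousAt.tendsto.comp ((tendsto_add_atTop_iff_nat N).2 hu))
  have hj0 : Tendsto (fun k => jacT F (z k) (y' k)) atTop (𝓝 v) := by
    have h1 : Tendsto (fun k => jacT F (z k) (y' k) - w (k + N)) atTop (𝓝 0) :=
      squeeze_zero_norm hjac hinv
    simpa using h1.add ((tendsto_add_atTop_iff_nat N).2 hw)
  obtain ⟨ε, hε, κ, hκ, hbound⟩ := hB.exists_bound hg hlsc hx hx' hF'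
  have hfreq : ∀ᶠ k in atTop, y' k ∈ Metric.closedBall (0 : G) (κ * (1 + (‖v‖ + 1))) := by
    filter_upwards [hz0.eventually (Metric.closedBall_mem_nhds x hε),
      hy0.eventually (Metric.closedBall_mem_nhds (F x) hε),
      hj0.norm.eventually (eventually_lt_nhds (lt_add_one ‖v‖))] with k h1 h2 h3
    rw [mem_closedBall_zero_iff]
    refine (hbound (z k) (y k) (y' k) (mem_closedBall_iff_norm.1 h1) (mem_closedBall_iff_norm.1 h2)
      (hy' k)).trans ?_
    gcongr
  obtain ⟨y₀, -, φ, hφ, hlim⟩ :=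
    tendsto_subseq_of_frequently_bounded Metric.isBounded_closedBall hfreq.frequently
  refine ⟨y₀, mem_convSubdiff_of_tendsto hlsc hx hx' (hy0.comp hφ.tendsto_atTop) hlim
    fun k => hy' (φ k), ?_⟩
  have h1 : Tendsto (fun k => jacT F (z (φ k))) atTop (𝓝 (jacT F x)) :=
    (continuousAt_jacT hF').tendsto.comp (hz0.comp hφ.tendsto_atTop)
  exact tendsto_nhds_unique (tendsto_clm_apply h1 hlim) (hj0.comp hφ.tendsto_atTop)

/-- The convex inequality at `F u` leaves only `y'` paired with the linearization error, which is
`o(‖u - x‖)`. -/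
theorem jacT_mem_regSubdiff {F : E → G} {g : G → EReal} {x : E} {y' : G}
    (hF : DifferentiableAt ℝ F x) (hy : y' ∈ convSubdiff g (F x)) :
    jacT F x y' ∈ regSubdiff (fun z => g (F z)) x := by
  refine ⟨hy.1, hy.2.1, fun ε hε => ?_⟩
  have hc : 0 < ε / (‖y'‖ + 1) := by positivity
  filter_upwards [hF.hasFDerivAt.isLittleO.bound hc] with u hu
  refine le_trans ?_ (hy.2.2 (F u))
  gcongr
  rw [jacT_inner]
  have h1 : ⟪y', fderiv ℝ F x (u - x)⟫_ℝ - ⟪y', F u - F x⟫_ℝ =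
      ⟪y', -(F u - F x - fderiv ℝ F x (u - x))⟫_ℝ := by
    rw [← inner_sub_right]; congr 1; abel
  have h2 : ⟪y', -(F u - F x - fderiv ℝ F x (u - x))⟫_ℝ ≤ ε * ‖u - x‖ := by
    refine (real_inner_le_norm _ _).trans ?_
    rw [norm_neg]
    calc ‖y'‖ * ‖F u - F x - fderiv ℝ F x (u - x)‖
        ≤ (‖y'‖ + 1) * (ε / (‖y'‖ + 1) * ‖u - x‖) := by gcongr; linarith
      _ = ε * ‖u - x‖ := by field_simp
  linarith

/-- The subdifferential chain rule under the basic constraint qualification. -/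
theorem subdiff_comp {F : E → G} {g : G → EReal} (hg : IsConvexFun g)
    (hlsc : LowerSemicontinuous g) {x : E} (hF : ContDiffAt ℝ 1 F x) (hB : BCQ F g x) :
    subdiff (fun z => g (F z)) x = jacT F x '' convSubdiff g (F x) := by
  ext v
  constructor
  · rintro ⟨h1, h2, u, w, hu, hw, -, h⟩
    exact exists_multiplier_of_tendsto hg hlsc hF hB h1 h2 hu hw h
  · rintro ⟨y', hy', rfl⟩
    exact regSubdiff_subset_subdiff _ _
      (jacT_mem_regSubdiff (hF.differentiableAt one_ne_zero) hy')

/-- Subgradients of `g ∘ F` near `x` have multipliers bounded in terms of their norms. -/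
theorem exists_bounded_multiplier {F : E → G} {g : G → EReal} (hg : IsConvexFun g)
    (hlsc : LowerSemicontinuous g) {x : E} (hF : ContDiffAt ℝ 1 F x) (hB : BCQ F g x)
    (hx : g (F x) ≠ ⊤) (hx' : g (F x) ≠ ⊥) :
    ∃ κ > 0, ∀ᶠ u in 𝓝 x, ∀ w ∈ subdiff (fun z => g (F z)) u,
      ∃ y' ∈ convSubdiff g (F u), jacT F u y' = w ∧ ‖y'‖ ≤ κ * (1 + ‖w‖) := by
  have hF' : ContinuousAt (fderiv ℝ F) x := hF.continuousAt_fderiv one_ne_zero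
  obtain ⟨ε, hε, κ, hκ, hbound⟩ := hB.exists_bound hg hlsc hx hx' hF'
  have hBev : ∀ᶠ u in 𝓝 x, F u ∈ effDom g → BCQ F g u := by
    have h1 : Tendsto (fun u : E => (u, (0 : G))) (𝓝 x) (𝓝 (x, 0)) :=
      (Continuous.prodMk_left (0 : G)).tendsto x
    simpa using h1.eventually (hB.eventually hg hx.lt_top hF.continuousAt hF')
  refine ⟨κ, hκ, ?_⟩
  filter_upwards [hBev, hF.eventually (by simp), Metric.closedBall_mem_nhds x hε,
    hF.continuousAt.eventually (Metric.closedBall_mem_nhds (F x) hε)] with u h1 h2 h3 h4 w hw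
  have hw' := hw
  rw [subdiff_comp hg hlsc h2 (h1 hw.1.lt_top)] at hw'
  obtain ⟨y', hy', rfl⟩ := hw'
  exact ⟨y', hy', rfl, hbound u (F u) y' (mem_closedBall_iff_norm.1 h3)
    (mem_closedBall_iff_norm.1 h4) hy'⟩

/-- The lower estimate is semicontinuity. The upper one tests the subgradient inequality based at `F
(u k)` at the point `F x`; bounded multipliers make the linear term vanish. -/
theorem subdiffContinuousAt_comp {F : E → G} {g : G → EReal} (hg : IsConvexFun g)
    (hlsc : LowerSemicontinuous g) {x : E} (hF : ContDiffAt ℝ 1 F x) (hB : BCQ F g x) :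
    SubdiffContinuousAt (fun z => g (F z)) x := by
  intro v hv u w hw hu hwv
  obtain ⟨γ, hγ⟩ : ∃ γ : ℝ, g (F x) = γ := ⟨_, (EReal.coe_toReal hv.1 hv.2.1).symm⟩
  obtain ⟨κ, hκ, hbound⟩ := exists_bounded_multiplier hg hlsc hF hB hv.1 hv.2.1
  have hFu : Tendsto (fun k => F (u k)) atTop (𝓝 (F x)) := hF.continuousAt.tendsto.comp hu
  refine tendsto_order.2 ⟨fun a ha => hFu.eventually (hlsc _ _ ha), fun a ha => ?_⟩
  obtain ⟨b, hb1, hb2⟩ := EReal.lt_iff_exists_real_btwn.1 ha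
  have hγb : γ < b := by
    have : g (F x) < b := hb1
    rw [hγ] at this
    exact_mod_cast this
  have hsmall : Tendsto (fun k => γ + κ * (1 + ‖w k‖) * ‖F x - F (u k)‖) atTop (𝓝 γ) := by
    have h1 := ((hwv.norm.const_add 1).const_mul κ).mul (hFu.const_sub (F x)).norm
    simpa using h1.const_add γ
  filter_upwards [hu.eventually hbound, hsmall.eventually (eventually_lt_nhds hγb)] with k h1 h2
  obtain ⟨y', hy', -, hnorm⟩ := h1 (w k) (hw k)
  obtain ⟨α, hα⟩ := exists_real_of_mem_convSubdiff hy'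
  have h3 := (mem_convSubdiff_iff_real hα).1 hy' (F x) γ hγ.le
  have h4 : -⟪y', F x - F (u k)⟫_ℝ ≤ κ * (1 + ‖w k‖) * ‖F x - F (u k)‖ :=
    (neg_le_abs _).trans ((abs_real_inner_le_norm _ _).trans (by gcongr))
  refine lt_trans ?_ hb2
  rw [hα]
  exact_mod_cast (by linarith : α < b)

theorem proxRegularAt_comp {F : E → G} {g : G → EReal} (hg : IsConvexFun g)
    (hlsc : LowerSemicontinuous g) {x : E} (hF : ContDiffAt ℝ 2 F x) (hB : BCQ F g x) :
    ProxRegularAt (fun z => g (F z)) x := by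
  intro v hv
  have hF1 : ContDiffAt ℝ 1 F x := hF.of_le (by norm_num)
  refine ⟨⟨_, hF1.eventually (by simp), fun u hu a ha => ?_⟩, hv.1, hv.2.1, hv, ?_⟩
  · have h1 : ContDiffAt ℝ 1 F u := hu
    exact (h1.continuousAt.eventually (hlsc _ _ ha)).filter_mono nhdsWithin_le_nhds
  obtain ⟨κ, hκ, hbound⟩ := exists_bounded_multiplier hg hlsc hF1 hB hv.1 hv.2.1
  obtain ⟨K, hK, ε₁, hε₁, hquad⟩ := exists_norm_sub_sub_fderiv_le hF
  obtain ⟨ε₂, hε₂, hball⟩ := Metric.nhds_basis_closedBall.eventually_iff.1 hbound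
  set ε := min ε₁ ε₂
  set M := κ * (1 + (‖v‖ + ε)) with hM
  have hεpos : 0 < ε := lt_min hε₁ hε₂
  -- `M` bounds the multipliers of all `w` within `ε` of `v`, and `K` is the quadratic error
  -- constant; the factor `2` offsets `r / 2`.
  refine ⟨ε, hεpos, 2 * (M * K), by positivity, fun u' hu' u hu w hw hwu _ => ?_⟩
  obtain ⟨y', hy', rfl, hnorm⟩ :=
    hball (Metric.closedBall_subset_closedBall (min_le_right _ _) hu) w hwu
  have hw' : ‖jacT F u y'‖ ≤ ‖v‖ + ε :=
    norm_le_of_mem_closedBall hw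
  have hnorm' : ‖y'‖ ≤ M := hnorm.trans (by rw [hM]; gcongr)
  have h1 := hquad u (Metric.closedBall_subset_closedBall (min_le_left _ _) hu) u'
    (Metric.closedBall_subset_closedBall (min_le_left _ _) hu')
  refine le_trans ?_ (hy'.2.2 (F u'))
  gcongr
  rw [jacT_inner]
  have h2 : ⟪y', fderiv ℝ F u (u' - u)⟫_ℝ - ⟪y', F u' - F u⟫_ℝ =
      ⟪y', -(F u' - F u - fderiv ℝ F u (u' - u))⟫_ℝ := by
    rw [← inner_sub_right]; congr 1; abel
  have h3 : ⟪y', -(F u' - F u - fderiv ℝ F u (u' - u))⟫_ℝ ≤ M * (K * ‖u' - u‖ ^ 2) := by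
    refine (real_inner_le_norm _ _).trans ?_
    rw [norm_neg]
    gcongr
  linarith

end ChainRule

end VarAnal

theorem mainTheorem9 {n m : ℕ}
    (F : EuclideanSpace ℝ (Fin n) → EuclideanSpace ℝ (Fin m))
    (g : EuclideanSpace ℝ (Fin m) → EReal)
    (xbar : EuclideanSpace ℝ (Fin n)) (ybar' : EuclideanSpace ℝ (Fin m))
    (hF : ContDiffAt ℝ 1 F xbar)
    (hg_lsc : LowerSemicontinuous g) (hg_conv : VarAnal.IsConvexFun g)
    (hdom : F xbar ∈ VarAnal.effDom g)
    (hybar : ybar' ∈ VarAnal.subdiff g (F xbar))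
    (hSOQC : VarAnal.SOQC F g xbar ybar') :
    VarAnal.BCQ F g xbar ∧
    ∃ U : Set (EuclideanSpace ℝ (Fin n) × EuclideanSpace ℝ (Fin m)),
      IsOpen U ∧ (xbar, 0) ∈ U ∧
      ∀ (x : EuclideanSpace ℝ (Fin n)) (b : EuclideanSpace ℝ (Fin m)), (x, b) ∈ U →
        F x + b ∈ VarAnal.effDom g →
        VarAnal.BCQ (fun z => F z + b) g x ∧
        VarAnal.subdiff (fun z => g (F z + b)) x =
          VarAnal.jacT (fun z => F z + b) x '' VarAnal.subdiff g (F x + b) ∧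
        (ContDiffAt ℝ 2 F xbar →
          VarAnal.ProxRegularAt (fun z => g (F z + b)) x ∧
          VarAnal.SubdiffContinuousAt (fun z => g (F z + b)) x) := by
  have hB := hSOQC.bcq hg_conv hg_lsc hybar
  refine ⟨hB, ?_⟩
  have h1 := hB.eventually hg_conv hdom hF.continuousAt (hF.continuousAt_fderiv one_ne_zero)
  have h2 : ∀ᶠ x in 𝓝 xbar, ContDiffAt ℝ 1 F x := hF.eventually (by simp)
  -- The `C²` assumption is stated inside the quantifiers over `U`, `x` and `b`, so its persistence
  -- is recorded as an implication before `U` is chosen.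
  have h3 : ∀ᶠ x in 𝓝 xbar, ContDiffAt ℝ 2 F xbar → ContDiffAt ℝ 2 F x := by
    by_cases h : ContDiffAt ℝ 2 F xbar
    · filter_upwards [h.eventually (by simp)] with x hx _ using hx
    · exact Eventually.of_forall fun x hx => absurd hx h
  have hfst : Tendsto Prod.fst (𝓝 (xbar, (0 : EuclideanSpace ℝ (Fin m)))) (𝓝 xbar) :=
    continuous_fst.tendsto _
  obtain ⟨U, hU, hUo, hUx⟩ := eventually_nhds_iff.1
    (h1.and ((hfst.eventually h2).and (hfst.eventually h3)))
  refine ⟨U, hUo, hUx, fun x b hxb hdomx => ?_⟩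
  obtain ⟨hBx, hC1, hC2⟩ := hU _ hxb
  have hBx := hBx hdomx
  have hC1' : ContDiffAt ℝ 1 (fun z => F z + b) x := hC1.add contDiffAt_const
  refine ⟨hBx, ?_, fun hC => ⟨?_, ?_⟩⟩
  · rw [hg_conv.subdiff_eq hg_lsc]
    exact VarAnal.subdiff_comp hg_conv hg_lsc hC1' hBx
  · exact VarAnal.proxRegularAt_comp hg_conv hg_lsc ((hC2 hC).add contDiffAt_const) hBx
  · exact VarAnal.subdiffContinuousAt_comp hg_conv hg_lsc hC1' hBx
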